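/- Let $\Sigma$ be a finite alphabet, $\#\notin\Sigma$ and $\hat\Sigma=\Sigma\cup\{\#\}$. An $\omega$-picture over $\Sigma$ is a function $p:\omega\times\omega\to\hat\Sigma$ with $p(i,0)=p(0,i)=\#$ for all $i\ge 0$ and $p(i,j)\in\Sigma$ for all $i,j>0$; $\Sigma^{\omega,\omega}$ is the set of all of them. A Büchi tiling system over $\Sigma$ consists of a finite set $Q$ of states, a set $\Delta\subseteq(\hat\Sigma\times Q)^4$ of $2\times 2$ tiles and a set $F\subseteq Q$ of accepting states. An accepting run on $p\in\Sigma^{\omega,\omega}$ is a map $\rho:\omega\times\omega\to Q$ such that, writing $b_{i,j}=(p(i,j),\rho(i,j))$, one has $$\begin{pmatrix} b_{i,j+1} & b_{i+1,j+1}\\ b_{i,j} & b_{i+1,j}\end{pmatrix}\in\Delta\quad\text{for all } i,j\ge 0,$$ and $\rho(v)\in F$ for infinitely many $v\in\omega\times\omega$. The language of the system is the set of $p\in\Sigma^{\omega,\omega}$ that have an accepting run, and the system is unambiguous if every $p\in\Sigma^{\omega,\omega}$ has at most one accepting run. A language $L\subseteq\Sigma^{\omega,\omega}$ is Büchi-recognizable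 if it is the language of some Büchi tiling system over $\Sigma$; a Büchi-recognizable language is inherently ambiguous if it is not the language of any unambiguous Büchi tiling system over $\Sigma$. **Corollary.** There exist a finite alphabet $\Sigma$ and a Büchi-recognizable language $L\subseteq\Sigma^{\omega,\omega}$ that is inherently ambiguous. -/

import Mathlib

/-- The extended alphabet `A ∪ {#}`; the border letter `#` is `none`. -/
abbrev BorderedAlphabet (A : Type*) : Type _ := Option A

/-- `ω`-pictures over `A`: functions `p : ω × ω → A ∪ {#}` with `p(i, 0) = p(0, i) = #` for all `i`,
and `p(i, j) ∈ A` for `i, j > 0`. -/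
def OmegaPicture (A : Type*) : Type _ :=
  {p : ℕ × ℕ → BorderedAlphabet A //
    (∀ i, p (i, 0) = none ∧ p (0, i) = none) ∧
    ∀ i j, 0 < i → 0 < j → ∃ a : A, p (i, j) = some a}

/-- A `2 × 2` tile over `Γ`, with `topLeft, topRight` above `botLeft, botRight`. -/
structure Tile (Γ : Type*) where
  topLeft : Γ
  topRight : Γ
  botLeft : Γ
  botRight : Γ

/-- The tile of `x : ω × ω → Γ` at `(i, j)`; the first coordinate grows to the right and the
second one upwards. -/
def tileAt {Γ : Type*} (x : ℕ × ℕ → Γ) (i j : ℕ) : Tile Γ where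
  topLeft := x (i, j + 1)
  topRight := x (i + 1, j + 1)
  botLeft := x (i, j)
  botRight := x (i + 1, j)

/-- A tiling system with states `Q` and alphabet `A` is a set of tiles over `(A ∪ {#}) × Q`.
Finiteness of `Q` and `A` is required wherever tiling systems are quantified over. -/
structure TilingSystem (Q A : Type*) where
  tiles : Set (Tile (BorderedAlphabet A × Q))

/-- A Büchi tiling system: a tiling system with a set of accepting states. -/
structure BuchiTilingSystem (Q A : Type*) extends TilingSystem Q A where
  accepting : Set Q

/-- `ρ` is a run of the tiling system on the `ω`-picture `p`. -/
def TilingSystem.IsRun {Q A : Type*} (T : TilingSystem Q A) (p : OmegaPicture A)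
    (ρ : ℕ × ℕ → Q) : Prop :=
  ∀ i j : ℕ, tileAt (fun v => (p.1 v, ρ v)) i j ∈ T.tiles

/-- `ρ` is an accepting run on `p`: a run that visits accepting states at infinitely many
positions. -/
def BuchiTilingSystem.IsAcceptingRun {Q A : Type*} (T : BuchiTilingSystem Q A)
    (p : OmegaPicture A) (ρ : ℕ × ℕ → Q) : Prop :=
  T.IsRun p ρ ∧ {v : ℕ × ℕ | ρ v ∈ T.accepting}.Infinite

/-- The language of `ω`-pictures Büchi-recognized by `T`. -/
def BuchiTilingSystem.language {Q A : Type*} (T : BuchiTilingSystem Q A) :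
    Set (OmegaPicture A) :=
  {p | ∃ ρ, T.IsAcceptingRun p ρ}

/-- `T` is unambiguous if every `ω`-picture has at most one accepting run. -/
def BuchiTilingSystem.IsUnambiguous {Q A : Type*} (T : BuchiTilingSystem Q A) : Prop :=
  ∀ (p : OmegaPicture A) (ρ ρ' : ℕ × ℕ → Q),
    T.IsAcceptingRun p ρ → T.IsAcceptingRun p ρ' → ρ = ρ'

/-- `L` is accepted by some Büchi tiling system with finitely many states. -/
def IsBuchiRecognizable {A : Type*} (L : Set (OmegaPicture A)) : Prop :=
  ∃ (Q : Type) (_ : Finite Q) (T : BuchiTilingSystem Q A), T.language = L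

/-- `L` is accepted by some unambiguous Büchi tiling system with finitely many states. -/
def IsUnambiguousLanguage {A : Type*} (L : Set (OmegaPicture A)) : Prop :=
  ∃ (Q : Type) (_ : Finite Q) (T : BuchiTilingSystem Q A), T.IsUnambiguous ∧ T.language = L

/-- A Büchi-recognizable language is inherently ambiguous if it is not unambiguous. -/
def IsInherentlyAmbiguous {A : Type*} (L : Set (OmegaPicture A)) : Prop :=
  IsBuchiRecognizable L ∧ ¬ IsUnambiguousLanguage L

/-! An unambiguous system has a Borel language: the pairs (picture, accepting run) form a Borel set
on which the projection to the picture is injective, so Lusin–Souslin applies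
(`BuchiTilingSystem.measurableSet_image_language`). It therefore suffices to recognize a non-Borel
language. For `cliqueLanguage`, a run guesses the clique (`cliqueSystem_language`). It is not Borel
because the Borel map `selectionMatrix` reduces `selectionSet` to it, and the complement of
`selectionSet` is not even analytic, by diagonalization (`not_analyticSet_compl_selectionSet`). -/

/-! ### A Büchi-recognizable language of pictures with an infinite clique -/

/-- The pictures, read as adjacency matrices over `Bool`, that have an infinite clique. -/
def cliqueLanguage : Set (OmegaPicture Bool) :=
  {p | ∃ S : Set ℕ, S.Infinite ∧ ∀ i ∈ S, ∀ j ∈ S, p.1 (i, j) = some true}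

/-- A tiling system for `cliqueLanguage`. The three components of a state say that the column
belongs to the guessed clique, that the row does, and that the position is on the diagonal. -/
def cliqueSystem : BuchiTilingSystem (Prop × Prop × Prop) Bool where
  tiles := {t |
    (t.topLeft.2.1 ↔ t.botLeft.2.1) ∧
    (t.botRight.2.2.1 ↔ t.botLeft.2.2.1) ∧
    (t.topRight.2.2.2 ↔ t.botLeft.2.2.2) ∧
    (t.botLeft.1 = none →
      (t.botLeft.2.2.2 ↔ t.topLeft.1 = none ∧ t.botRight.1 = none)) ∧
    (t.botLeft.2.2.2 → (t.botLeft.2.1 ↔ t.botLeft.2.2.1)) ∧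
    (t.botLeft.2.1 → t.botLeft.2.2.1 → t.botLeft.1 = some true)}
  accepting := {q | q.1 ∧ q.2.2}

theorem OmegaPicture.eq_none_iff {A : Type*} (p : OmegaPicture A) (i j : ℕ) :
    p.1 (i, j) = none ↔ i = 0 ∨ j = 0 := by
  constructor
  · intro h
    by_contra! hij
    obtain ⟨a, ha⟩ := p.2.2 i j (by omega) (by omega)
    simp [h] at ha
  · rintro (rfl | rfl)
    · exact (p.2.1 j).2
    · exact (p.2.1 i).1

theorem cliqueSystem_language : cliqueSystem.language = cliqueLanguage := by
  ext p
  constructor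
  · rintro ⟨ρ, hrun, hinf⟩
    have hcol : ∀ i j, (ρ (i, j)).1 ↔ (ρ (i, 0)).1 := by
      intro i j
      induction j with
      | zero => rfl
      | succ j ih => exact (hrun i j).1.trans ih
    have hrow : ∀ i j, (ρ (i, j)).2.1 ↔ (ρ (0, j)).2.1 := by
      intro i j
      induction i with
      | zero => rfl
      | succ i ih => exact (hrun i j).2.1.trans ih
    -- On the border, only the corner has `#` both above it and to its right; the diagonal flag
    -- spreads from there.
    have hborder : ∀ i j, i = 0 ∨ j = 0 → ((ρ (i, j)).2.2 ↔ i = j) := by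
      intro i j hij
      have h : (ρ (i, j)).2.2 ↔ p.1 (i, j + 1) = none ∧ p.1 (i + 1, j) = none :=
        (hrun i j).2.2.2.1 ((p.eq_none_iff i j).2 hij)
      rw [h, p.eq_none_iff, p.eq_none_iff]
      omega
    have hdiag : ∀ i j, (ρ (i, j)).2.2 ↔ i = j := by
      intro i
      induction i with
      | zero => exact fun j => hborder 0 j (Or.inl rfl)
      | succ i ih =>
        intro j
        cases j with
        | zero => exact hborder _ 0 (Or.inr rfl)
        | succ j =>
          have h : (ρ (i + 1, j + 1)).2.2 ↔ (ρ (i, j)).2.2 := (hrun i j).2.2.1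
          rw [h, ih]
          omega
    -- The row and column guesses are compared where row `i` meets column `i`, so both describe one
    -- set.
    have hsymm : ∀ i, (ρ (i, 0)).1 ↔ (ρ (0, i)).2.1 := fun i =>
      (hcol i i).symm.trans (((hrun i i).2.2.2.2.1 ((hdiag i i).2 rfl)).trans (hrow i i))
    refine ⟨{i | (ρ (i, 0)).1}, fun hfin => hinf ?_, fun i hi j hj => ?_⟩
    · refine (hfin.image fun i => (i, i)).subset ?_
      rintro ⟨i, j⟩ ⟨h1, h2⟩
      obtain rfl := (hdiag i j).1 h2
      exact ⟨i, (hcol i i).1 h1, rfl⟩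
    · exact (hrun i j).2.2.2.2.2 ((hcol i j).2 hi) ((hrow i j).2 ((hsymm j).1 hj))
  · rintro ⟨S, hS, hclique⟩
    refine ⟨fun v => (v.1 ∈ S, v.2 ∈ S, v.1 = v.2), fun i j => ?_, ?_⟩
    · refine ⟨Iff.rfl, Iff.rfl, Nat.succ_inj, fun h => ?_, ?_, fun hi hj => hclique i hi j hj⟩
      · change i = j ↔ p.1 (i, j + 1) = none ∧ p.1 (i + 1, j) = none
        have hij := (p.eq_none_iff i j).1 h
        rw [p.eq_none_iff, p.eq_none_iff]
        omega
      · rintro (h : i = j)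
        change i ∈ S ↔ j ∈ S
        rw [h]
    · refine (hS.image (f := fun i => (i, i)) fun i _ j _ h => (Prod.mk.inj h).1).mono ?_
      rintro _ ⟨i, hi, rfl⟩
      exact ⟨hi, rfl⟩

/-! ### Unambiguous languages are Borel -/

theorem BuchiTilingSystem.measurableSet_image_language {Q A : Type*} [Countable Q] [Countable A]
    [MeasurableSpace (Option A)] [DiscreteMeasurableSpace (Option A)]
    (T : BuchiTilingSystem Q A) (hT : T.IsUnambiguous) :
    MeasurableSet (Subtype.val '' T.language : Set (ℕ × ℕ → Option A)) := by
  let : MeasurableSpace Q := ⊤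
  have hQ : DiscreteMeasurableSpace Q := ⟨fun _ => trivial⟩
  have hpic : ∀ v (s : Set (Option A)),
      Measurable fun x : (ℕ × ℕ → Option A) × (ℕ × ℕ → Q) => x.1 v ∈ s := fun v s =>
    (measurable_mem.2 (MeasurableSet.of_discrete (s := s))).comp
      ((measurable_pi_apply v).comp measurable_fst)
  have hstate : ∀ v (s : Set Q),
      Measurable fun x : (ℕ × ℕ → Option A) × (ℕ × ℕ → Q) => x.2 v ∈ s := fun v s =>
    (measurable_mem.2 (MeasurableSet.of_discrete (s := s))).comp
      ((measurable_pi_apply v).comp measurable_snd)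
  have hcell : ∀ v, Measurable
      fun x : (ℕ × ℕ → Option A) × (ℕ × ℕ → Q) => ((x.1 v, x.2 v) : Option A × Q) := fun v =>
    ((measurable_pi_apply v).comp measurable_fst).prodMk
      ((measurable_pi_apply v).comp measurable_snd)
  have htile : ∀ i j, Measurable fun x : (ℕ × ℕ → Option A) × (ℕ × ℕ → Q) =>
      tileAt (fun v => (x.1 v, x.2 v)) i j ∈ T.tiles := by
    intro i j
    let C := Option A × Q
    have hC : Measurable fun c : C × C × C × C =>
        (⟨c.1, c.2.1, c.2.2.1, c.2.2.2⟩ : Tile C) ∈ T.tiles := Measurable.of_discrete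
    exact hC.comp ((hcell (i, j + 1)).prodMk ((hcell (i + 1, j + 1)).prodMk
      ((hcell (i, j)).prodMk (hcell (i + 1, j)))))
  set R : Set ((ℕ × ℕ → Option A) × (ℕ × ℕ → Q)) :=
    {x | ((∀ i, x.1 (i, 0) ∈ ({none} : Set (Option A)) ∧ x.1 (0, i) ∈ ({none} : Set (Option A))) ∧
        ∀ i j, 0 < i → 0 < j → x.1 (i, j) ∈ Set.range (some : A → Option A)) ∧
      (∀ i j, tileAt (fun v => (x.1 v, x.2 v)) i j ∈ T.tiles) ∧
      -- Infinitude is phrased with countable quantifiers to make measurability immediate.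
      ∀ s : Finset (ℕ × ℕ), ∃ v, v ∉ s ∧ x.2 v ∈ T.accepting} with hR
  have hRmeas : MeasurableSet R := by
    refine measurableSet_setOfPred.2 (((Measurable.forall fun i => (hpic _ _).and (hpic _ _)).and
      (Measurable.forall fun i => Measurable.forall fun j => Measurable.forall fun _ =>
        Measurable.forall fun _ => hpic _ _)).and
      ((Measurable.forall fun i => Measurable.forall fun j => htile i j).and
        (Measurable.forall fun s => Measurable.exists fun v =>
          measurable_const.and (hstate _ _))))
  have hRiff : ∀ x, x ∈ R ↔ ∃ p : OmegaPicture A, p.1 = x.1 ∧ T.IsAcceptingRun p x.2 := by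
    rintro ⟨x, ρ⟩
    have hinf : {v | ρ v ∈ T.accepting}.Infinite ↔
        ∀ s : Finset (ℕ × ℕ), ∃ v, v ∉ s ∧ ρ v ∈ T.accepting := by
      constructor
      · intro h s
        obtain ⟨v, hv, hvs⟩ := h.exists_notMem_finset s
        exact ⟨v, hvs, hv⟩
      · intro h hfin
        obtain ⟨v, hvs, hv⟩ := h hfin.toFinset
        exact hvs (hfin.mem_toFinset.2 hv)
    constructor
    · rintro ⟨⟨h0, h1⟩, h2, h3⟩
      exact ⟨⟨x, h0, fun i j hi hj => (h1 i j hi hj).imp fun _ h => h.symm⟩, rfl, h2, hinf.2 h3⟩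
    · rintro ⟨⟨_, h0, h1⟩, rfl, h2, h3⟩
      exact ⟨⟨h0, fun i j hi hj => (h1 i j hi hj).imp fun _ h => h.symm⟩, h2, hinf.1 h3⟩
  have himage : Subtype.val '' T.language = Prod.fst '' R := by
    ext x
    constructor
    · rintro ⟨p, ⟨ρ, hρ⟩, rfl⟩
      exact ⟨(p.1, ρ), (hRiff _).2 ⟨p, rfl, hρ⟩, rfl⟩
    · rintro ⟨⟨_, ρ⟩, hx, rfl⟩
      obtain ⟨p, hp, hρ⟩ := (hRiff _).1 hx
      exact ⟨p, ⟨ρ, hρ⟩, hp⟩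
  rw [himage]
  -- Lusin–Souslin; injectivity is exactly unambiguity.
  refine hRmeas.image_of_measurable_injOn measurable_fst ?_
  rintro ⟨x, ρ⟩ hx ⟨y, ρ'⟩ hy (rfl : x = y)
  obtain ⟨p, hp, hρ⟩ := (hRiff _).1 hx
  obtain ⟨p', hp', hρ'⟩ := (hRiff _).1 hy
  obtain rfl : p = p' := Subtype.ext (hp.trans hp'.symm)
  exact Prod.ext rfl (hT p ρ ρ' hρ hρ')

/-! ### Existence of infinite cliques is not Borel -/

/-- The list of the first `n` values of a sequence. -/
def initialSegment {α : Type*} (x : ℕ → α) (n : ℕ) : List α := (List.range n).map x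

theorem initialSegment_length {α : Type*} (x : ℕ → α) (n : ℕ) :
    (initialSegment x n).length = n := by simp [initialSegment]

theorem initialSegment_eq_iff {α : Type*} {x y : ℕ → α} {n : ℕ} :
    initialSegment x n = initialSegment y n ↔ ∀ k < n, x k = y k := by
  simp [initialSegment]

theorem initialSegment_prefix {α : Type*} (x : ℕ → α) {m n : ℕ} (h : m ≤ n) :
    initialSegment x m <+: initialSegment x n := by
  obtain ⟨k, rfl⟩ := Nat.exists_eq_add_of_le h
  rw [initialSegment, initialSegment, List.range_add, List.map_append]
  exact List.prefix_append _ _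

/-- `x` codes a set of pairs of lists; the list `v` is selected if the pair of the initial segment
of `x` of the same length and `v` is in this set. -/
def Selects (x : ℕ → Bool) (v : List ℕ) : Prop :=
  x (Encodable.encode (initialSegment x v.length, v)) = true

/-- The sequences `x` that select infinitely many initial segments of some `y`. -/
def selectionSet : Set (ℕ → Bool) :=
  {x | ∃ y : ℕ → ℕ, {n | Selects x (initialSegment y n)}.Infinite}

open Filter Topology in
theorem tendsto_of_eq_initialSegment {α : Type*} [TopologicalSpace α] {x : ℕ → α}
    {z : ℕ → ℕ → α} {l : Filter ℕ} (hl : l ≤ atTop)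
    (h : ∀ᶠ n in l, initialSegment (z n) n = initialSegment x n) : Tendsto z l (𝓝 x) := by
  refine tendsto_pi_nhds.2 fun k => tendsto_const_nhds.congr' ?_
  filter_upwards [h, hl (eventually_gt_atTop k)] with n hn hk
  exact (initialSegment_eq_iff.1 hn k hk).symm

-- If the complement were the range of a continuous `f` on Baire space, let `t` code all finite
-- approximations to the graph of `f`. Then `t` lies in `selectionSet` iff it lies in the range of
-- `f`, a contradiction.
open Filter Topology in
theorem not_analyticSet_compl_selectionSet : ¬ MeasureTheory.AnalyticSet selectionSetᶜ := by
  rw [MeasureTheory.AnalyticSet]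
  rintro (h | ⟨f, hf, hrange⟩)
  · have : (fun _ => false) ∈ selectionSet := by
      rw [Set.compl_empty_iff.1 h]
      trivial
    obtain ⟨y, hy⟩ := this
    obtain ⟨n, hn⟩ := hy.nonempty
    exact Bool.false_ne_true hn
  · classical
    set P : List Bool × List ℕ → Prop := fun w =>
      ∃ y, initialSegment y w.2.length = w.2 ∧ initialSegment (f y) w.2.length = w.1 with hP
    set t : ℕ → Bool := fun k => decide (∃ w, Encodable.encode w = k ∧ P w) with ht
    have hsel : ∀ v, Selects t v ↔ P (initialSegment t v.length, v) := by
      intro v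
      rw [Selects]
      conv_lhs => rw [ht]
      rw [decide_eq_true_iff]
      constructor
      · rintro ⟨w, hw, hPw⟩
        exact Encodable.encode_injective hw ▸ hPw
      · exact fun h => ⟨_, rfl, h⟩
    have hiff : t ∈ selectionSet ↔ t ∈ Set.range f := by
      constructor
      · rintro ⟨y, hy⟩
        have hex : ∀ n, ∃ z, Selects t (initialSegment y n) →
            initialSegment z n = initialSegment y n ∧
              initialSegment (f z) n = initialSegment t n := by
          intro n
          by_cases h : Selects t (initialSegment y n)
          · obtain ⟨z, hz, hz'⟩ := (hsel _).1 h
            simp only [initialSegment_length] at hz hz'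
            exact ⟨z, fun _ => ⟨hz, hz'⟩⟩
          · exact ⟨y, fun h' => (h h').elim⟩
        choose z hz using hex
        -- Along the selected lengths `z n` tends to `y` and `f (z n)` to `t`, so `f y = t` by
        -- continuity.
        set l : Filter ℕ := atTop ⊓ 𝓟 {n | Selects t (initialSegment y n)} with hl
        have : l.NeBot := by
          rw [hl, ← frequently_mem_iff_neBot]
          exact Nat.frequently_atTop_iff_infinite.2 hy
        have hmem : ∀ᶠ n in l, Selects t (initialSegment y n) :=
          mem_inf_of_right (mem_principal_self _)
        have hzy : Tendsto z l (𝓝 y) :=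
          tendsto_of_eq_initialSegment inf_le_left (hmem.mono fun n hn => (hz n hn).1)
        have hzt : Tendsto (fun n => f (z n)) l (𝓝 t) :=
          tendsto_of_eq_initialSegment inf_le_left (hmem.mono fun n hn => (hz n hn).2)
        exact ⟨y, tendsto_nhds_unique ((hf.tendsto y).comp hzy) hzt⟩
      · rintro ⟨y, hy⟩
        refine ⟨y, Set.infinite_univ.mono fun n _ => (hsel _).2 ⟨y, ?_, ?_⟩⟩
        · rw [initialSegment_length]
        · rw [hy]
    rw [hrange] at hiff
    exact iff_not_self hiff

/-- An infinite chain of lists consists of initial segments of a sequence. -/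
theorem exists_forall_eq_initialSegment {α : Type*} {V : Set (List α)} (hV : V.Infinite)
    (hchain : ∀ v ∈ V, ∀ w ∈ V, v <+: w ∨ w <+: v) :
    ∃ y : ℕ → α, ∀ v ∈ V, v = initialSegment y v.length := by
  have hinj : Set.InjOn List.length V := by
    intro v hv w hw h
    rcases hchain v hv w hw with hp | hp
    · exact hp.eq_of_length h
    · exact (hp.eq_of_length h.symm).symm
  have hlong : ∀ k, ∃ v ∈ V, k < v.length := by
    intro k
    obtain ⟨_, ⟨v, hv, rfl⟩, hk⟩ := (hV.image hinj).exists_gt k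
    exact ⟨v, hv, hk⟩
  choose g hg hlen using hlong
  refine ⟨fun k => (g k)[k]'(hlen k), fun v hv => List.ext_getElem ?_ fun k hk hk' => ?_⟩
  · rw [initialSegment_length]
  · simp only [initialSegment, List.getElem_map, List.getElem_range]
    rcases hchain v hv _ (hg k) with hp | hp
    · exact hp.getElem hk
    · exact (hp.getElem (hlen k)).symm

open Classical in
/-- The picture of the graph on lists whose edges join comparable lists selected by `x`. -/
noncomputable def selectionMatrix (x : ℕ → Bool) : ℕ × ℕ → Option Bool
  | (i + 1, j + 1) =>
    let v := Denumerable.ofNat (List ℕ) i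
    let w := Denumerable.ofNat (List ℕ) j
    some (decide ((v <+: w ∨ w <+: v) ∧ Selects x v ∧ Selects x w))
  | (_, _) => none

theorem selectionMatrix_succ_eq_true_iff (x : ℕ → Bool) (v w : List ℕ) :
    selectionMatrix x (Encodable.encode v + 1, Encodable.encode w + 1) = some true ↔
      (v <+: w ∨ w <+: v) ∧ Selects x v ∧ Selects x w := by
  simp [selectionMatrix]

/-- `selectionMatrix x` as an `ω`-picture. -/
noncomputable def selectionPicture (x : ℕ → Bool) : OmegaPicture Bool :=
  ⟨selectionMatrix x, fun i => ⟨by cases i <;> rfl, by cases i <;> rfl⟩, by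
    rintro (_ | i) (_ | j) hi hj
    · omega
    · omega
    · omega
    · exact ⟨_, rfl⟩⟩

theorem selectionPicture_mem_cliqueLanguage (x : ℕ → Bool) :
    selectionPicture x ∈ cliqueLanguage ↔ x ∈ selectionSet := by
  set e : List ℕ → ℕ := fun v => Encodable.encode v + 1 with he
  have hinj : Function.Injective e := fun v w h =>
    Encodable.encode_injective (Nat.succ_injective h)
  constructor
  · rintro ⟨S, hS, hclique⟩
    -- A clique avoids the index 0, whose row is the border.
    have hSe : S ⊆ Set.range e := by
      rintro (_ | i) hi
      · have h := hclique 0 hi 0 hi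
        simp [(selectionPicture x).2.1 0] at h
      · exact ⟨Denumerable.ofNat (List ℕ) i, by simp [he]⟩
    have hV : (e ⁻¹' S).Infinite := hS.preimage hSe
    have hadj : ∀ v ∈ e ⁻¹' S, ∀ w ∈ e ⁻¹' S,
        (v <+: w ∨ w <+: v) ∧ Selects x v ∧ Selects x w := fun v hv w hw =>
      (selectionMatrix_succ_eq_true_iff x v w).1 (hclique _ hv _ hw)
    obtain ⟨y, hy⟩ := exists_forall_eq_initialSegment hV fun v hv w hw => (hadj v hv w hw).1
    refine ⟨y, fun hfin => hV ((hfin.image (initialSegment y)).subset fun v hv => ?_)⟩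
    refine ⟨v.length, ?_, (hy v hv).symm⟩
    rw [Set.mem_ofPred_eq, ← hy v hv]
    exact (hadj v hv v hv).2.1
  · rintro ⟨y, hy⟩
    have hinj' : Function.Injective fun n => e (initialSegment y n) := fun m n h => by
      simpa [initialSegment_length] using congrArg List.length (hinj h)
    refine ⟨_, hy.image hinj'.injOn, ?_⟩
    rintro _ ⟨m, hm, rfl⟩ _ ⟨n, hn, rfl⟩
    refine (selectionMatrix_succ_eq_true_iff x _ _).2 ⟨?_, hm, hn⟩
    exact (le_total m n).imp (initialSegment_prefix y) (initialSegment_prefix y)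

theorem measurableSet_selects (v : List ℕ) : MeasurableSet {x | Selects x v} := by
  have hcoord : ∀ k, Measurable fun x : ℕ → Bool => x k := fun k => measurable_pi_apply k
  have hsegment : ∀ u : List Bool,
      MeasurableSet {x : ℕ → Bool | initialSegment x v.length = u} := by
    intro u
    by_cases hu : ∃ z, initialSegment z v.length = u
    · obtain ⟨z, rfl⟩ := hu
      simp only [initialSegment_eq_iff]
      exact measurableSet_setOfPred.2 (Measurable.forall fun k => Measurable.forall fun _ =>
        (hcoord k).eq_const (z k))
    · convert MeasurableSet.empty
      exact Set.eq_empty_of_forall_notMem fun x hx => hu ⟨x, hx⟩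
  -- The coordinate being read depends on `x` itself, hence the countable split over the possible
  -- initial segments.
  have : {x | Selects x v} = ⋃ u : List Bool, {x | initialSegment x v.length = u} ∩
      {x | x (Encodable.encode (u, v)) = true} := by
    ext x
    simp [Selects]
  rw [this]
  exact MeasurableSet.iUnion fun u => (hsegment u).inter
    (measurableSet_setOfPred.2 ((hcoord _).eq_const true))

theorem measurable_selectionMatrix [MeasurableSpace (Option Bool)]
    [DiscreteMeasurableSpace (Option Bool)] : Measurable selectionMatrix := by
  classical
  refine measurable_pi_lambda _ ?_
  rintro ⟨_ | i, _ | j⟩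
  · exact measurable_const
  · exact measurable_const
  · exact measurable_const
  · set v := Denumerable.ofNat (List ℕ) i
    set w := Denumerable.ofNat (List ℕ) j
    have h : MeasurableSet {x | (v <+: w ∨ w <+: v) ∧ Selects x v ∧ Selects x w} :=
      (MeasurableSet.const _).inter ((measurableSet_selects v).inter (measurableSet_selects w))
    have hite : (fun x => selectionMatrix x (i + 1, j + 1)) = fun x =>
        if (v <+: w ∨ w <+: v) ∧ Selects x v ∧ Selects x w then some true else some false := by
      funext x
      split_ifs with hx
      · exact congrArg some (decide_eq_true hx)
      · exact congrArg some (decide_eq_false hx)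
    rw [hite]
    exact Measurable.ite h measurable_const measurable_const

theorem not_measurableSet_image_cliqueLanguage [MeasurableSpace (Option Bool)]
    [DiscreteMeasurableSpace (Option Bool)] :
    ¬ MeasurableSet (Subtype.val '' cliqueLanguage : Set (ℕ × ℕ → Option Bool)) := by
  intro h
  have hpre : selectionMatrix ⁻¹' (Subtype.val '' cliqueLanguage) = selectionSet := by
    ext x
    rw [← selectionPicture_mem_cliqueLanguage]
    exact Subtype.val_injective.mem_set_image (a := selectionPicture x)
  have hmeas : MeasurableSet selectionSet := hpre ▸ measurable_selectionMatrix h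
  have : TopologicalSpace.SeparableSpace (ℕ → Bool) := inferInstance
  have : TopologicalSpace.IsCompletelyMetrizableSpace (ℕ → Bool) :=
    TopologicalSpace.IsCompletelyMetrizableSpace.pi_countable
  have : PolishSpace (ℕ → Bool) := inferInstance
  exact not_analyticSet_compl_selectionSet hmeas.compl.analyticSet

theorem mainTheorem6 :
    ∃ (A : Type) (_ : Finite A) (L : Set (OmegaPicture A)), IsInherentlyAmbiguous L := by
  refine ⟨Bool, inferInstance, cliqueLanguage,
    ⟨_, inferInstance, cliqueSystem, cliqueSystem_language⟩, ?_⟩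
  rintro ⟨Q, _, T, hT, hlang⟩
  let : MeasurableSpace (Option Bool) := ⊤
  have : DiscreteMeasurableSpace (Option Bool) := ⟨fun _ => trivial⟩
  exact not_measurableSet_image_cliqueLanguage (hlang ▸ T.measurableSet_image_language hT)
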